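/- Let $\Gamma=\langle a,s,t \mid [a,a^t]=1,\ [s,t]=1,\ a^s=aa^t\rangle$ be Baumslag's group, where $[x,y]=x^{-1}y^{-1}xy$ and $x^y=y^{-1}xy$. For a finite presentation $\langle A\mid R\rangle$ and a word $w$ on $A^{\pm1}$ representing the identity, let $\mathrm{Area}(w)$ be the least $N$ such that $w$ is freely equal to a product $\prod_{i=1}^N u_i^{-1}r_iu_i$ with words $u_i$ on $A^{\pm1}$ and $r_i\in R^{\pm1}$, and let the Dehn function $\mathrm{Area}(n)$ be the maximum of $\mathrm{Area}(w)$ over all words $w$ of length at most $n$ that represent the identity. For $f,g:\mathbb N\to\mathbb N$ write $f\preceq g$ if there is $C>0$ with $f(n)\le C\,g(Cn+C)+Cn+C$ for all $n$, and $f\simeq g$ if $f\preceq g$ and $g\preceq f$. Then the Dehn function of $\Gamma$ satisfies $\mathrm{Area}(n)\simeq 2^n$, both for the presentation above and for every finite presentation of $\Gamma$. -/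

import Mathlib

namespace BaumslagDehn

/-! Words on an alphabet `α` are lists over `α × Bool` (a letter with its exponent `+1` or `-1`, as
in `FreeGroup.mk`), not necessarily reduced. A presentation `⟨α | R⟩` is a set
`R : Set (FreeGroup α)` of relators, and the group that it presents is `PresentedGroup R`. -/

section Dehn

variable {α : Type*}

/-- The word `w` represents the identity of the group `⟨α | R⟩`. -/
def RepresentsOne (R : Set (FreeGroup α)) (w : List (α × Bool)) : Prop :=
  PresentedGroup.mk R (FreeGroup.mk w) = 1

/-- The word `w` is freely equal to a product of `N` factors `u⁻¹ * r * u` with `r ∈ R^{±1}`;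
the factors are listed as pairs `(u, r)`. -/
def IsProductOfConjugates (R : Set (FreeGroup α)) (w : List (α × Bool)) (N : ℕ) : Prop :=
  ∃ l : List (FreeGroup α × FreeGroup α),
    l.length = N ∧
    (∀ p ∈ l, p.2 ∈ R ∨ p.2⁻¹ ∈ R) ∧
    FreeGroup.mk w = (l.map fun p => p.1⁻¹ * p.2 * p.1).prod

/-- The area of a word `w` that represents the identity: the least `N` such that `w` is freely
equal to a product of `N` conjugates of relators and inverses of relators. -/
noncomputable def area (R : Set (FreeGroup α)) (w : List (α × Bool)) : ℕ :=
  sInf {N | IsProductOfConjugates R w N}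

/-- The Dehn function of `⟨α | R⟩`: the maximum of the areas of the words of length at most `n`
that represent the identity. (For a finite alphabet there are finitely many such words.) -/
noncomputable def dehnFunction (R : Set (FreeGroup α)) (n : ℕ) : ℕ :=
  sSup {A | ∃ w : List (α × Bool), w.length ≤ n ∧ RepresentsOne R w ∧ area R w = A}

/-- For a finite alphabet the supremum in the Dehn function is a maximum. -/
theorem dehnFunction_isGreatest [Finite α] (R : Set (FreeGroup α)) (n : ℕ) :
    IsGreatest {A | ∃ w : List (α × Bool), w.length ≤ n ∧ RepresentsOne R w ∧ area R w = A}
      (dehnFunction R n) := by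
  have hfin : {A | ∃ w : List (α × Bool), w.length ≤ n ∧ RepresentsOne R w ∧
      area R w = A}.Finite := by
    refine ((List.finite_length_le (α × Bool) n).image (area R)).subset ?_
    rintro A ⟨w, hw, -, rfl⟩
    exact ⟨w, hw, rfl⟩
  have hne : {A | ∃ w : List (α × Bool), w.length ≤ n ∧ RepresentsOne R w ∧
      area R w = A}.Nonempty := by
    refine ⟨area R [], [], Nat.zero_le n, ?_, rfl⟩
    exact map_one (PresentedGroup.mk R)
  exact ⟨Nat.sSup_mem hne hfin.bddAbove, fun _ h => le_csSup hfin.bddAbove h⟩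

end Dehn

/-- `f ≼ g`: there is `C > 0` with `f n ≤ C * g (C * n + C) + C * n + C` for all `n`. -/
def AsympLE (f g : ℕ → ℕ) : Prop :=
  ∃ C : ℕ, 0 < C ∧ ∀ n : ℕ, f n ≤ C * g (C * n + C) + C * n + C

/-- `f ≃ g`: both `f ≼ g` and `g ≼ f`. -/
def AsympEquiv (f g : ℕ → ℕ) : Prop :=
  AsympLE f g ∧ AsympLE g f

/-- `[x, y] = x⁻¹ y⁻¹ x y`. -/
def comm {G : Type*} [Group G] (x y : G) : G := x⁻¹ * y⁻¹ * x * y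

/-- `x ^ y = y⁻¹ x y`. -/
def conjBy {G : Type*} [Group G] (x y : G) : G := y⁻¹ * x * y

/-- The three generators of Baumslag's group. -/
inductive Gen : Type
  | a
  | s
  | t

instance : Finite Gen :=
  Finite.of_surjective (fun i : Fin 3 => if i = 0 then Gen.a else if i = 1 then Gen.s else Gen.t)
    (by
      intro x
      cases x
      · exact ⟨0, rfl⟩
      · exact ⟨1, rfl⟩
      · exact ⟨2, rfl⟩)

/-- The relators of `⟨a, s, t | [a, a^t] = 1, [s, t] = 1, a^s = a a^t⟩`. -/
def baumslagRels : Set (FreeGroup Gen) :=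
  let a := FreeGroup.of Gen.a
  let s := FreeGroup.of Gen.s
  let t := FreeGroup.of Gen.t
  {comm a (conjBy a t), comm s t, conjBy a s * (a * conjBy a t)⁻¹}

/-- Baumslag's group `Γ`. -/
abbrev BaumslagGroup : Type := PresentedGroup baumslagRels

end BaumslagDehn

/-!
Throughout, `a_i` denotes `a ^ (t ^ i)`. Area is a conjugation-invariant length on the free group;
`Near R N x y` says that `x` is rewritten to `y` by at most `N` applications of relators, so that
costs add up along products and chains.

*Upper bound.* Baumslag's group is `ℤ[x, 1/x, 1/(1+x)] ⋊ ℤ²`, with `t` acting as `x` and `s` as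
`1 + x`. Conjugating `[a_0, a_k] = 1` by `s` yields `[a_0, a_(k+1)] = 1`, so these commutators have
area at most `8 ^ k` (`near_aConj_zero_comm`). Conjugating a word of length at most `n` by
`t ^ n * s ^ n` makes all exponents of `t` and `s` on the letters `a` nonnegative; each of these
letters then expands, like `x ^ p * (1 + x) ^ q`, to exponentially many `a_i`, and these are
collected into a product `∏ a_i ^ e_i` at exponential cost (`near_normalForm`). If the word
represents the identity, then exponent sums and the affine action with `x` transcendental show that
the normal form is trivial, so nothing remains to be paid for (`areaLE_of_representsOne`).

*Lower bound.* The free group on `a, s, t` acts on the plane so that `a` is a Heisenberg element,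
on whose two off-diagonal entries `t` acts by the conjugates `φ`, `ψ` and `s` by `1 + φ`, `1 + ψ`.
The choice of the golden ratio makes `φ * ψ = -1` and `(1 + φ) * (1 + ψ) = 1`, so that conjugation
at most changes the sign of central elements. The relators act by translations in the central
direction, and hence a product of `N` of their conjugates is a translation of length at most
`3 * N` (`AreaLE.lift_eq_translation`). But `[a_0, a_(2n)]`, which is given by a word of length
linear in `n`, is the translation by `ψ ^ (2n) - φ ^ (2n)`, which is exponentially long.

*Other presentations.* Translating words between two finite presentations of a group multiplies
areas by at most a constant, and translating back and forth moves a word by an area linear in its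
length (`dehnFunction_asympLE_of_mulEquiv`).
-/

namespace BaumslagDehn

/-! ### Area as a conjugation-invariant length on the free group -/

section Area

variable {α : Type*} {R : Set (FreeGroup α)} {N M K : ℕ}

/-- The element `g` of the free group is a product of at most `N` conjugates of elements of
`R^{±1}`. -/
def AreaLE (R : Set (FreeGroup α)) (N : ℕ) (g : FreeGroup α) : Prop :=
  ∃ l : List (FreeGroup α × FreeGroup α),
    l.length ≤ N ∧
    (∀ p ∈ l, p.2 ∈ R ∨ p.2⁻¹ ∈ R) ∧
    g = (l.map fun p => p.1⁻¹ * p.2 * p.1).prod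

theorem AreaLE.mono {g : FreeGroup α} (h : AreaLE R N g) (hNM : N ≤ M) : AreaLE R M g := by
  obtain ⟨l, hl, h1, h2⟩ := h
  exact ⟨l, hl.trans hNM, h1, h2⟩

theorem AreaLE.one : AreaLE R N 1 := ⟨[], by simp, by simp, by simp⟩

theorem AreaLE.of_mem {r : FreeGroup α} (hr : r ∈ R) : AreaLE R 1 r :=
  ⟨[(1, r)], by simp, by simp [hr], by simp⟩

theorem AreaLE.mul {g h : FreeGroup α} (hg : AreaLE R N g) (hh : AreaLE R M h) :
    AreaLE R (N + M) (g * h) := by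
  obtain ⟨l, hl, h1, rfl⟩ := hg
  obtain ⟨l', hl', h1', rfl⟩ := hh
  refine ⟨l ++ l', by simp; omega, ?_, by simp⟩
  intro p hp
  rcases List.mem_append.1 hp with hp | hp
  · exact h1 p hp
  · exact h1' p hp

theorem AreaLE.conj {g : FreeGroup α} (hg : AreaLE R N g) (x : FreeGroup α) :
    AreaLE R N (x⁻¹ * g * x) := by
  obtain ⟨l, hl, h1, rfl⟩ := hg
  refine ⟨l.map fun p => (p.1 * x, p.2), by simpa using hl, ?_, ?_⟩
  · intro p hp
    obtain ⟨p', hp', rfl⟩ := List.mem_map.1 hp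
    exact h1 p' hp'
  · clear hl h1
    induction l with
    | nil => simp
    | cons p l ih =>
      simp only [List.map_cons, List.prod_cons] at ih ⊢
      rw [← ih]
      group

theorem AreaLE.inv {g : FreeGroup α} (hg : AreaLE R N g) : AreaLE R N g⁻¹ := by
  obtain ⟨l, hl, h1, rfl⟩ := hg
  induction l generalizing N with
  | nil => simpa using AreaLE.one
  | cons p l ih =>
    have h2 : AreaLE R 1 (p.1⁻¹ * p.2⁻¹ * p.1) :=
      ⟨[(p.1, p.2⁻¹)], by simp, by simpa [or_comm] using h1 p (by simp), by simp⟩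
    have h3 := (ih le_rfl fun q hq => h1 q (by simp [hq])).mul h2
    simp only [List.length_cons] at hl
    convert h3.mono hl using 1
    simp only [List.map_cons, List.prod_cons]
    group

theorem AreaLE.mk_eq_one {g : FreeGroup α} (hg : AreaLE R N g) : PresentedGroup.mk R g = 1 := by
  obtain ⟨l, -, h1, rfl⟩ := hg
  rw [map_list_prod]
  apply List.prod_eq_one
  intro x hx
  simp only [List.map_map, List.mem_map, Function.comp] at hx
  obtain ⟨p, hp, rfl⟩ := hx
  have h : PresentedGroup.mk R p.2 = 1 := by
    rcases h1 p hp with h | h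
    · exact PresentedGroup.one_of_mem h
    · simpa using PresentedGroup.one_of_mem h
  simp [h]

theorem exists_areaLE {g : FreeGroup α} (hg : PresentedGroup.mk R g = 1) : ∃ N, AreaLE R N g := by
  rw [PresentedGroup.mk_eq_one_iff, Subgroup.normalClosure] at hg
  induction hg using Subgroup.closure_induction with
  | mem x hx =>
    obtain ⟨r, hr, hx⟩ := Group.mem_conjugatesOfSet_iff.1 hx
    obtain ⟨c, rfl⟩ := isConj_iff.1 hx
    exact ⟨1, by simpa using (AreaLE.of_mem hr).conj c⁻¹⟩
  | one => exact ⟨0, .one⟩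
  | mul x y _ _ hx hy =>
    obtain ⟨N, hN⟩ := hx
    obtain ⟨M, hM⟩ := hy
    exact ⟨_, hN.mul hM⟩
  | inv x _ hx =>
    obtain ⟨N, hN⟩ := hx
    exact ⟨_, hN.inv⟩

theorem area_le {w : List (α × Bool)} (h : AreaLE R N (FreeGroup.mk w)) : area R w ≤ N := by
  obtain ⟨l, hl, h1, h2⟩ := h
  exact (Nat.sInf_le (show IsProductOfConjugates R w l.length from ⟨l, rfl, h1, h2⟩)).trans hl

theorem areaLE_area {w : List (α × Bool)} (h : RepresentsOne R w) :
    AreaLE R (area R w) (FreeGroup.mk w) := by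
  obtain ⟨_, l, _, h1, h2⟩ := exists_areaLE h
  have hne : {N | IsProductOfConjugates R w N}.Nonempty := ⟨l.length, l, rfl, h1, h2⟩
  obtain ⟨l', hl', h⟩ := Nat.sInf_mem hne
  exact ⟨l', hl'.le, h⟩

theorem area_le_dehnFunction [Finite α] {w : List (α × Bool)} {n : ℕ} (hw : w.length ≤ n)
    (h : RepresentsOne R w) : area R w ≤ dehnFunction R n :=
  (dehnFunction_isGreatest R n).2 ⟨w, hw, h, rfl⟩

theorem dehnFunction_le [Finite α] {n B : ℕ}
    (h : ∀ w : List (α × Bool), w.length ≤ n → RepresentsOne R w → AreaLE R B (FreeGroup.mk w)) :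
    dehnFunction R n ≤ B := by
  obtain ⟨w, hw, hw1, hA⟩ := (dehnFunction_isGreatest R n).1
  exact hA ▸ area_le (h w hw hw1)

theorem dehnFunction_mono [Finite α] : Monotone (dehnFunction R) := by
  intro m n hmn
  exact dehnFunction_le fun w hw h =>
    (areaLE_area h).mono (area_le_dehnFunction (hw.trans hmn) h)

/-- Two elements of the free group are within distance `N` in the bi-invariant pseudo-metric
given by area: one can be rewritten to the other with at most `N` applications of relators. -/
def Near (R : Set (FreeGroup α)) (N : ℕ) (x y : FreeGroup α) : Prop :=
  AreaLE R N (x * y⁻¹)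

namespace Near

variable {x y z x' y' : FreeGroup α}

theorem mono (h : Near R N x y) (hNM : N ≤ M) : Near R M x y := AreaLE.mono h hNM

theorem refl (x : FreeGroup α) : Near R N x x := by
  simpa [Near] using AreaLE.one

theorem of_eq (h : x = y) : Near R N x y := h ▸ refl x

theorem symm (h : Near R N x y) : Near R N y x := by
  simpa [Near] using AreaLE.inv h

theorem trans (h : Near R N x y) (h' : Near R M y z) : Near R (N + M) x z := by
  simpa [Near, mul_assoc] using AreaLE.mul h h'

theorem mul (h : Near R N x y) (h' : Near R M x' y') : Near R (N + M) (x * x') (y * y') := by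
  have h1 := (AreaLE.conj h' x⁻¹).mul h
  rw [add_comm] at h1
  unfold Near
  convert h1 using 1
  group

theorem mul_left (z : FreeGroup α) (h : Near R N x y) : Near R N (z * x) (z * y) := by
  simpa using (refl (R := R) (N := 0) z).mul h

theorem mul_right (z : FreeGroup α) (h : Near R N x y) : Near R N (x * z) (y * z) := by
  simpa using h.mul (refl (R := R) (N := 0) z)

theorem inv (h : Near R N x y) : Near R N x⁻¹ y⁻¹ := by
  have h1 := AreaLE.conj (AreaLE.inv h) y
  unfold Near
  convert AreaLE.conj h1 (y⁻¹ * x * y⁻¹ * y) using 1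
  group

theorem conj (z : FreeGroup α) (h : Near R N x y) : Near R N (z⁻¹ * x * z) (z⁻¹ * y * z) :=
  (h.mul_left z⁻¹).mul_right z

theorem cancel_left (h : Near R N (z * x) (z * y)) : Near R N x y := by
  simpa using h.mul_left z⁻¹

theorem cancel_right (h : Near R N (x * z) (y * z)) : Near R N x y := by
  simpa using h.mul_right z⁻¹

theorem mk_eq (h : Near R N x y) : PresentedGroup.mk R x = PresentedGroup.mk R y := by
  simpa [mul_inv_eq_one] using AreaLE.mk_eq_one h

theorem commute_inv (h : Near R N (x * y) (y * x)) : Near R N (x * y⁻¹) (y⁻¹ * x) := by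
  simpa [mul_assoc] using ((h.mul_left y⁻¹).mul_right y⁻¹).symm

theorem commute_mul (h : Near R N (x * y) (y * x)) (h' : Near R M (x * z) (z * x)) :
    Near R (N + M) (x * (y * z)) (y * z * x) := by
  have h1 := h.mul_right z
  have h2 := h'.mul_left y
  simpa [mul_assoc] using h1.trans (by simpa [mul_assoc] using h2)

theorem commute_pow (h : Near R N (x * y) (y * x)) (k : ℕ) :
    Near R (k * N) (x * y ^ k) (y ^ k * x) := by
  induction k with
  | zero => exact of_eq (by simp)
  | succ k ih => exact pow_succ y k ▸ (ih.commute_mul h).mono (by rw [Nat.succ_mul])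

theorem commute_zpow (h : Near R N (x * y) (y * x)) (k : ℤ) :
    Near R (k.natAbs * N) (x * y ^ k) (y ^ k * x) := by
  obtain ⟨k, rfl | rfl⟩ := k.eq_nat_or_neg
  · simpa using h.commute_pow k
  · simpa using (h.commute_pow k).commute_inv

theorem zpow_commute_zpow (h : Near R N (x * y) (y * x)) (j k : ℤ) :
    Near R (j.natAbs * (k.natAbs * N)) (x ^ j * y ^ k) (y ^ k * x ^ j) :=
  ((h.commute_zpow k).symm.commute_zpow j).symm

end Near

/-! ### Products of powers of almost commuting elements -/

/-- The normal form `b 0 ^ e 0 * ⋯ * b (m - 1) ^ e (m - 1)`. -/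
def powProd {G : Type*} [Group G] (b : ℕ → G) (e : ℕ → ℤ) : ℕ → G
  | 0 => 1
  | m + 1 => powProd b e m * b m ^ e m

/-- The `ℓ¹`-norm of the first `m` exponents. -/
def expNorm (e : ℕ → ℤ) (m : ℕ) : ℕ := ∑ i ∈ Finset.range m, (e i).natAbs

theorem powProd_zero {G : Type*} [Group G] (b : ℕ → G) {e : ℕ → ℤ} {m : ℕ}
    (he : ∀ i < m, e i = 0) : powProd b e m = 1 := by
  induction m with
  | zero => rfl
  | succ m ih => simp [powProd, ih fun i hi => he i (by omega), he m (by omega)]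

theorem powProd_single {G : Type*} [Group G] (b : ℕ → G) {p m : ℕ} (hp : p < m) :
    powProd b (Pi.single p 1) m = b p := by
  induction m with
  | zero => omega
  | succ m ih =>
    rcases Nat.lt_succ_iff_lt_or_eq.1 hp with h | rfl
    · simp [powProd, ih h, show m ≠ p by omega]
    · rw [powProd, powProd_zero]
      · simp
      · intro i hi
        simp [show i ≠ p by omega]

theorem expNorm_add (e f : ℕ → ℤ) (m : ℕ) : expNorm (e + f) m ≤ expNorm e m + expNorm f m := by
  rw [expNorm, expNorm, expNorm, ← Finset.sum_add_distrib]
  exact Finset.sum_le_sum fun i _ => Int.natAbs_add_le _ _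

theorem expNorm_neg (e : ℕ → ℤ) (m : ℕ) : expNorm (-e) m = expNorm e m := by
  simp [expNorm]

theorem map_powProd {G H : Type*} [Group G] [Group H] (f : G →* H) (b : ℕ → G) (e : ℕ → ℤ)
    (m : ℕ) : f (powProd b e m) = powProd (fun i => f (b i)) e m := by
  induction m with
  | zero => simp [powProd]
  | succ m ih => simp [powProd, ih]

theorem Near.commute_powProd {x : FreeGroup α} {b : ℕ → FreeGroup α} (e : ℕ → ℤ) {m : ℕ}
    (h : ∀ i < m, Near R K (x * b i) (b i * x)) :
    Near R (K * expNorm e m) (x * powProd b e m) (powProd b e m * x) := by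
  induction m with
  | zero => exact Near.of_eq (by simp [powProd])
  | succ m ih =>
    refine ((ih fun i hi => h i (by omega)).commute_mul
      ((h m (by omega)).commute_zpow (e m))).mono (le_of_eq ?_)
    rw [expNorm, expNorm, Finset.sum_range_succ]
    ring

/-- If the `b i` commute pairwise at cost `K`, then adding up the exponents of two normal forms
costs at most `K` times the product of the norms of the exponents. -/
theorem Near.powProd_mul {b : ℕ → FreeGroup α} (e f : ℕ → ℤ) {m : ℕ}
    (h : ∀ i < m, ∀ j < m, Near R K (b i * b j) (b j * b i)) :
    Near R (K * expNorm e m * expNorm f m) (powProd b e m * powProd b f m)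
      (powProd b (e + f) m) := by
  induction m with
  | zero => exact Near.of_eq (by simp [powProd])
  | succ m ih =>
    have h1 := ih fun i hi j hj => h i (by omega) j (by omega)
    have h2 := ((Near.commute_powProd (m := m) f fun i hi =>
      h m (by omega) i (by omega)).symm.commute_zpow (e m)).symm
    have h3 := (h2.mul_left (powProd b e m)).mul_right (b m ^ f m)
    have h4 := h1.mul_right (b m ^ e m * b m ^ f m)
    have h5 := (Near.of_eq (R := R) (N := 0) (show powProd b e (m + 1) * powProd b f (m + 1) = _ by
      simp only [powProd, mul_assoc])).trans
      (h3.trans ((Near.of_eq (N := 0) (by simp only [mul_assoc])).trans h4))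
    have h6 := h5.trans (Near.of_eq (N := 0) (show _ = powProd b (e + f) (m + 1) by
      simp only [powProd, Pi.add_apply, zpow_add]))
    refine h6.mono ?_
    have he : expNorm e (m + 1) = expNorm e m + (e m).natAbs := Finset.sum_range_succ _ _
    have hf : expNorm f (m + 1) = expNorm f m + (f m).natAbs := Finset.sum_range_succ _ _
    rw [he, hf]
    have : 0 ≤ K * (expNorm e m + (e m).natAbs) * (f m).natAbs := Nat.zero_le _
    nlinarith

theorem Near.powProd_neg {b : ℕ → FreeGroup α} (e : ℕ → ℤ) {m : ℕ}
    (h : ∀ i < m, ∀ j < m, Near R K (b i * b j) (b j * b i)) :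
    Near R (K * expNorm e m * expNorm e m) (powProd b e m)⁻¹ (powProd b (-e) m) := by
  have h1 := Near.powProd_mul e (-e) h
  rw [add_neg_cancel, powProd_zero (e := 0) b (fun i _ => Pi.zero_apply i), expNorm_neg] at h1
  simpa using (h1.mul_left (powProd b e m)⁻¹).symm

/-! ### Independence of the presentation -/

/-- Homomorphisms out of a free group of finite rank stretch lengths at most linearly. -/
theorem exists_lift_length_le {β : Type*} [Finite α] (f : FreeGroup α →* FreeGroup β) :
    ∃ L : ℕ, ∀ w : List (α × Bool), ∃ v : List (β × Bool),
      v.length ≤ L * w.length ∧ FreeGroup.mk v = f (FreeGroup.mk w) := by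
  classical
  obtain ⟨L, hL⟩ := (Set.finite_range fun x : α => (f (FreeGroup.of x)).norm).bddAbove
  refine ⟨L, fun w => ⟨(f (FreeGroup.mk w)).toWord, ?_, FreeGroup.mk_toWord⟩⟩
  change (f (FreeGroup.mk w)).norm ≤ _
  induction w with
  | nil => rw [← FreeGroup.one_eq_mk]; simp
  | cons x w ih =>
    have hx : (f (FreeGroup.mk [x])).norm ≤ L := by
      have h1 : (f (FreeGroup.of x.1)).norm ≤ L := hL ⟨x.1, rfl⟩
      obtain ⟨x, _ | _⟩ := x
      · have : FreeGroup.mk [(x, false)] = (FreeGroup.of x)⁻¹ := rfl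
        rwa [this, map_inv, FreeGroup.norm_inv_eq]
      · exact h1
    have : FreeGroup.mk (x :: w) = FreeGroup.mk [x] * FreeGroup.mk w := by
      simp [FreeGroup.mul_mk]
    rw [this, map_mul, List.length_cons]
    refine (FreeGroup.norm_mul_le _ _).trans ?_
    rw [Nat.mul_succ]
    omega

theorem AreaLE.map {β : Type*} {S : Set (FreeGroup β)} (f : FreeGroup α →* FreeGroup β)
    (hK : ∀ r ∈ R, AreaLE S K (f r)) {g : FreeGroup α} (hg : AreaLE R N g) :
    AreaLE S (K * N) (f g) := by
  obtain ⟨l, hl, h1, rfl⟩ := hg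
  suffices h : AreaLE S (K * l.length) (f (l.map fun p => p.1⁻¹ * p.2 * p.1).prod) from
    h.mono (Nat.mul_le_mul_left K hl)
  clear hl
  induction l with
  | nil => simpa using AreaLE.one
  | cons p l ih =>
    have h2 : AreaLE S K (f p.2) := by
      rcases h1 p (by simp) with h | h
      · exact hK _ h
      · simpa using (hK _ h).inv
    have h3 := (h2.conj (f p.1)).mul (ih fun q hq => h1 q (by simp [hq]))
    simpa [Nat.mul_succ, add_comm] using h3

/-- An endomorphism of the free group that induces the identity on the presented group moves every
word by an area at most linear in its length. -/
theorem exists_near_map [Finite α] (f : FreeGroup α →* FreeGroup α)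
    (hf : ∀ x, PresentedGroup.mk R (f (FreeGroup.of x)) = PresentedGroup.mk R (FreeGroup.of x)) :
    ∃ K : ℕ, ∀ w : List (α × Bool),
      Near R (K * w.length) (FreeGroup.mk w) (f (FreeGroup.mk w)) := by
  have h : ∀ x : α, ∃ N, Near R N (FreeGroup.of x) (f (FreeGroup.of x)) := fun x =>
    exists_areaLE (by simp [hf x])
  choose N hN using h
  obtain ⟨K, hK⟩ := (Set.finite_range N).bddAbove
  refine ⟨K, fun w => ?_⟩
  induction w with
  | nil => exact Near.of_eq (by rw [← FreeGroup.one_eq_mk, map_one])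
  | cons x w ih =>
    have hx : Near R K (FreeGroup.mk [x]) (f (FreeGroup.mk [x])) := by
      have h1 := (hN x.1).mono (hK ⟨x.1, rfl⟩)
      obtain ⟨x, _ | _⟩ := x
      · have : FreeGroup.mk [(x, false)] = (FreeGroup.of x)⁻¹ := rfl
        rw [this, map_inv]
        exact h1.inv
      · exact h1
    have : FreeGroup.mk (x :: w) = FreeGroup.mk [x] * FreeGroup.mk w := by
      simp [FreeGroup.mul_mk]
    rw [this, map_mul]
    exact (hx.mul ih).mono (by rw [List.length_cons, Nat.mul_succ, add_comm])

theorem exists_lift_hom {β : Type*} {S : Set (FreeGroup β)} {G : Type*} [Group G]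
    (e : G →* PresentedGroup S) (x : α → G) :
    ∃ f : FreeGroup α →* FreeGroup β, ∀ g, PresentedGroup.mk S (f g) = e (FreeGroup.lift x g) := by
  choose y hy using fun i => PresentedGroup.mk_surjective S (e (x i))
  refine ⟨FreeGroup.lift y, fun g => ?_⟩
  have : (PresentedGroup.mk S).comp (FreeGroup.lift y) = e.comp (FreeGroup.lift x) := by
    ext i
    simp [hy]
  exact DFunLike.congr_fun this g

theorem lift_of_eq_mk (R : Set (FreeGroup α)) (g : FreeGroup α) :
    FreeGroup.lift (PresentedGroup.of (rels := R)) g = PresentedGroup.mk R g :=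
  DFunLike.congr_fun (FreeGroup.ext_hom (f := FreeGroup.lift (PresentedGroup.of (rels := R)))
    (g := PresentedGroup.mk R) fun x => by simp [PresentedGroup.of]) g

/-- Dehn functions of finite presentations of isomorphic groups are comparable. -/
theorem dehnFunction_asympLE_of_mulEquiv {β : Type*} [Finite α] [Finite β]
    {S : Set (FreeGroup β)} (hS : S.Finite) (e : PresentedGroup R ≃* PresentedGroup S) :
    AsympLE (dehnFunction R) (dehnFunction S) := by
  obtain ⟨f, hf⟩ := exists_lift_hom (α := α) e.toMonoidHom (PresentedGroup.of (rels := R))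
  obtain ⟨g, hg⟩ := exists_lift_hom (α := β) e.symm.toMonoidHom (PresentedGroup.of (rels := S))
  simp only [lift_of_eq_mk] at hf hg
  obtain ⟨L, hL⟩ := exists_lift_length_le f
  obtain ⟨K₂, hK₂⟩ := exists_near_map (R := R) (g.comp f) fun x => by
    simp [hg, hf]
  obtain ⟨K₁, hK₁⟩ : ∃ K, ∀ r ∈ S, AreaLE R K (g r) := by
    have h : ∀ r ∈ S, ∃ N, AreaLE R N (g r) := fun r hr =>
      exists_areaLE (by rw [hg, PresentedGroup.one_of_mem hr, map_one])
    choose! N hN using h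
    obtain ⟨K, hK⟩ := (hS.image N).bddAbove
    exact ⟨K, fun r hr => (hN r hr).mono (hK ⟨r, hr, rfl⟩)⟩
  refine ⟨L + K₁ + K₂ + 1, by omega, fun n => dehnFunction_le fun w hw hw1 => ?_⟩
  obtain ⟨v, hv, hvw⟩ := hL w
  have hv1 : RepresentsOne S v := by
    rw [RepresentsOne, hvw, hf, show PresentedGroup.mk R (FreeGroup.mk w) = 1 from hw1, map_one]
  have hLn : v.length ≤ (L + K₁ + K₂ + 1) * n + (L + K₁ + K₂ + 1) := by
    have : L * w.length ≤ L * n := Nat.mul_le_mul_left _ hw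
    nlinarith
  have h1 := ((areaLE_area hv1).mono (area_le_dehnFunction hLn hv1)).map g hK₁
  rw [hvw] at h1
  have h2 := AreaLE.mul (hK₂ w) h1
  rw [MonoidHom.comp_apply, inv_mul_cancel_right] at h2
  refine h2.mono ?_
  have : K₂ * w.length ≤ K₂ * n := Nat.mul_le_mul_left _ hw
  generalize dehnFunction S _ = D
  nlinarith

theorem AsympLE.trans {f g h : ℕ → ℕ} (hh : Monotone h) (hfg : AsympLE f g)
    (hgh : AsympLE g h) : AsympLE f h := by
  obtain ⟨C, hC, hC'⟩ := hfg
  obtain ⟨D, hD, hD'⟩ := hgh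
  refine ⟨2 * C * D + 2 * C * C * D + C + D + C * C * D, by positivity, fun n => ?_⟩
  set E := 2 * C * D + 2 * C * C * D + C + D + C * C * D with hE
  have h1 := hC' n
  have h2 := hD' (C * n + C)
  have h3 : h (D * (C * n + C) + D) ≤ h (E * n + E) := by
    apply hh
    nlinarith [Nat.zero_le (C * C * D), Nat.zero_le (C * D), Nat.zero_le (C * C * D * n),
      Nat.zero_le (C * D * n), Nat.zero_le (C * n), Nat.zero_le (D * n)]
  have h4 : C * g (C * n + C) ≤ C * (D * h (E * n + E) + D * (C * n + C) + D) :=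
    Nat.mul_le_mul_left _ (h2.trans (by gcongr))
  generalize h (E * n + E) = H at *
  have h5 : C * D * H ≤ E * H := Nat.mul_le_mul_right _ (by
    nlinarith [Nat.zero_le (C * C * D), Nat.zero_le (C * D)])
  nlinarith [Nat.zero_le (C * C * D), Nat.zero_le (C * D), Nat.zero_le (C * C * D * n),
      Nat.zero_le (C * D * n), Nat.zero_le (C * n), Nat.zero_le (D * n)]

end Area

/-! ### The exponential upper bound -/

section Upper

local notation "A" => FreeGroup.of Gen.a
local notation "S" => FreeGroup.of Gen.s
local notation "T" => FreeGroup.of Gen.t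

/-- The conjugate `a ^ (t ^ i)`, as an element of the free group. -/
def aConj (i : ℕ) : FreeGroup Gen := (T ^ i)⁻¹ * A * T ^ i

theorem aConj_add (i j : ℕ) : aConj (i + j) = (T ^ i)⁻¹ * aConj j * T ^ i := by
  simp only [aConj, add_comm i j, pow_add]
  group

theorem near_S_T : Near baumslagRels 1 (S * T) (T * S) := by
  have h : AreaLE baumslagRels 1 (comm S T) := .of_mem (by simp [baumslagRels])
  have h1 := AreaLE.conj h (S⁻¹ * T⁻¹)
  unfold Near
  convert h1 using 1
  simp only [comm]
  group

theorem near_aConj_zero_one :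
    Near baumslagRels 1 (aConj 0 * aConj 1) (aConj 1 * aConj 0) := by
  have h : AreaLE baumslagRels 1 (comm A (conjBy A T)) := .of_mem (by simp [baumslagRels])
  have h1 := AreaLE.conj h (A⁻¹ * (conjBy A T)⁻¹)
  unfold Near
  convert h1 using 1
  simp only [comm, conjBy, aConj]
  group

/-- `a_i ^ s` is rewritten to `a_i a_(i+1)`: the relator `a^s = a a^t` is used once, between
commutations of `s` with `t ^ i`. -/
theorem near_conj_S (i : ℕ) :
    Near baumslagRels (2 * i + 1) (S⁻¹ * aConj i * S) (aConj i * aConj (i + 1)) := by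
  have h : AreaLE baumslagRels 1 (conjBy A S * (A * conjBy A T)⁻¹) :=
    .of_mem (by simp [baumslagRels])
  have h0 : Near baumslagRels 1 (S⁻¹ * A * S) (A * (T⁻¹ * A * T)) := h
  have h1 : Near baumslagRels i (T ^ i * S) (S * T ^ i) := by
    simpa using (near_S_T.commute_pow i).symm
  have h2 := (h1.inv.mul_right A).mul h1
  have h3 := h2.trans ((Near.of_eq (N := 0)
    (show _ = (T ^ i)⁻¹ * (S⁻¹ * A * S) * T ^ i by group)).trans (h0.conj (T ^ i)))
  have h4 : S⁻¹ * aConj i * S = (T ^ i * S)⁻¹ * A * (T ^ i * S) := by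
    simp only [aConj]; group
  have h5 : aConj i * aConj (i + 1) = (T ^ i)⁻¹ * (A * (T⁻¹ * A * T)) * T ^ i := by
    simp only [aConj, pow_succ']; group
  rw [h4, h5]
  exact h3.mono (by omega)

/-- Conjugating `[a_0, a_k] = 1` by `s` gives `[a_0 a_1, a_k a_(k+1)] = 1`, from which
`[a_0, a_(k+1)] = 1` is extracted by means of the shorter commutators. -/
theorem near_aConj_zero_comm (k : ℕ) :
    Near baumslagRels (8 ^ k) (aConj 0 * aConj k) (aConj k * aConj 0) := by
  suffices h : Near baumslagRels (8 ^ k) (aConj 0 * aConj k) (aConj k * aConj 0) ∧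
      Near baumslagRels (8 ^ (k + 1)) (aConj 0 * aConj (k + 1)) (aConj (k + 1) * aConj 0) from h.1
  induction k with
  | zero => exact ⟨.refl _, near_aConj_zero_one.mono (by norm_num)⟩
  | succ k ih =>
    obtain ⟨ih0, ih1⟩ := ih
    refine ⟨ih1, ?_⟩
    have shift : ∀ {N j}, Near baumslagRels N (aConj 0 * aConj j) (aConj j * aConj 0) →
        Near baumslagRels N (aConj 1 * aConj (j + 1)) (aConj (j + 1) * aConj 1) := by
      intro N j h
      have := h.conj (T ^ 1)
      rw [add_comm j 1, aConj_add 1 j,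
        show aConj 1 = (T ^ 1)⁻¹ * aConj 0 * T ^ 1 from aConj_add 1 0]
      simpa [mul_assoc] using this
    have h01 := shift ih0
    have h12 := shift ih1
    have hs := ih1.conj S
    have hl := ((near_conj_S 0).mul (near_conj_S (k + 1))).symm
    have hr := (near_conj_S (k + 1)).mul (near_conj_S 0)
    have e1 : S⁻¹ * (aConj 0 * aConj (k + 1)) * S
        = S⁻¹ * aConj 0 * S * (S⁻¹ * aConj (k + 1) * S) := by group
    have e2 : S⁻¹ * (aConj (k + 1) * aConj 0) * S
        = S⁻¹ * aConj (k + 1) * S * (S⁻¹ * aConj 0 * S) := by group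
    rw [e1, e2] at hs
    have hmain := hl.trans (hs.trans hr)
    -- Both sides are brought to the form `a_(k+1) * _ * a_1`.
    have p1 := (h01.mul_left (aConj 0)).mul_right (aConj (k + 1 + 1))
    have p2 := (ih1.mul_right (aConj 1 * aConj (k + 1 + 1)))
    have p3 := h12.mul_left (aConj (k + 1) * aConj 0)
    simp only [mul_assoc, zero_add] at hmain p1 p2 p3
    have h := ((p1.trans (p2.trans p3)).symm.trans hmain).cancel_left
    simp only [← mul_assoc] at h
    refine h.cancel_right.mono ?_
    have hk : k + 1 ≤ 8 ^ k := Nat.succ_le_of_lt (Nat.lt_pow_self (by norm_num))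
    simp only [pow_succ]
    omega

theorem near_aConj_comm {m i j : ℕ} (hi : i ≤ m) (hj : j ≤ m) :
    Near baumslagRels (8 ^ m) (aConj i * aConj j) (aConj j * aConj i) := by
  have key : ∀ {i j : ℕ}, i ≤ j → j ≤ m →
      Near baumslagRels (8 ^ m) (aConj i * aConj j) (aConj j * aConj i) := by
    intro i j hij hj
    obtain ⟨k, rfl⟩ := Nat.exists_eq_add_of_le hij
    have h := ((near_aConj_zero_comm k).mono
      (Nat.pow_le_pow_right (by norm_num) (show k ≤ m by omega))).conj (T ^ i)
    rw [aConj_add i k, show aConj i = (T ^ i)⁻¹ * aConj 0 * T ^ i from aConj_add i 0]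
    simpa [mul_assoc] using h
  rcases le_total i j with h | h
  · exact key h hj
  · exact (key h hi).symm

/-- The coefficients of the polynomial `x ^ p * (1 + x) ^ q`. -/
def coeffs (p : ℕ) : ℕ → ℕ → ℤ
  | 0 => Pi.single p 1
  | q + 1 => coeffs p q + coeffs (p + 1) q

theorem expNorm_coeffs (q : ℕ) : ∀ p m : ℕ, expNorm (coeffs p q) m ≤ 2 ^ q := by
  induction q with
  | zero =>
    intro p m
    rw [coeffs, expNorm]
    have : ∀ i, ((Pi.single p 1 : ℕ → ℤ) i).natAbs = if i = p then 1 else 0 := by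
      intro i
      by_cases h : i = p <;> simp [h]
    simp only [this, Finset.sum_ite_eq', pow_zero]
    split_ifs <;> omega
  | succ q ih =>
    intro p m
    have h := expNorm_add (coeffs p q) (coeffs (p + 1) q) m
    have h1 := ih p m
    have h2 := ih (p + 1) m
    rw [coeffs, pow_succ]
    omega

/-- Pushing powers of `s` through `a_p` expands `x ^ p * (1 + x) ^ q` into monomials. -/
theorem near_conj_S_pow {m : ℕ} (q : ℕ) : ∀ p : ℕ, p + q ≤ m →
    Near baumslagRels (8 ^ m * 8 ^ q) ((S ^ q)⁻¹ * aConj p * S ^ q)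
      (powProd aConj (coeffs p q) (m + 1)) := by
  induction q with
  | zero =>
    intro p hp
    refine Near.of_eq ?_
    rw [coeffs, powProd_single _ (by omega)]
    simp
  | succ q ih =>
    intro p hp
    have h1 := (near_conj_S p).conj (S ^ q)
    have h2 := (ih p (by omega)).mul (ih (p + 1) (by omega))
    have h3 := Near.powProd_mul (b := aConj) (coeffs p q) (coeffs (p + 1) q) (m := m + 1)
      fun i hi j hj => near_aConj_comm (m := m) (by omega) (by omega)
    have e1 : (S ^ q)⁻¹ * (aConj p * aConj (p + 1)) * S ^ q
        = (S ^ q)⁻¹ * aConj p * S ^ q * ((S ^ q)⁻¹ * aConj (p + 1) * S ^ q) := by group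
    have e2 : (S ^ (q + 1))⁻¹ * aConj p * S ^ (q + 1)
        = (S ^ q)⁻¹ * (S⁻¹ * aConj p * S) * S ^ q := by rw [pow_succ']; group
    rw [e1] at h1
    rw [e2, coeffs]
    refine (h1.trans (h2.trans h3)).mono ?_
    have n1 : 2 * p + 1 ≤ 8 ^ m * 8 ^ q := by
      have : m < 2 ^ m := Nat.lt_pow_self (by norm_num)
      have h8 : 8 ^ m = 2 ^ m * 4 ^ m := by rw [← mul_pow]; norm_num
      have h4 : 4 ≤ 4 ^ m := by
        calc 4 = 4 ^ 1 := rfl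
          _ ≤ 4 ^ m := Nat.pow_le_pow_right (by norm_num) (by omega)
      calc 2 * p + 1 ≤ 2 ^ m * 4 := by omega
        _ ≤ 8 ^ m := h8 ▸ Nat.mul_le_mul_left _ h4
        _ ≤ 8 ^ m * 8 ^ q := Nat.le_mul_of_pos_right _ (by positivity)
    have n2 : 8 ^ m * expNorm (coeffs p q) (m + 1) * expNorm (coeffs (p + 1) q) (m + 1)
        ≤ 8 ^ m * 8 ^ q := by
      rw [mul_assoc]
      refine Nat.mul_le_mul_left _ ?_
      calc _ ≤ 2 ^ q * 2 ^ q := Nat.mul_le_mul (expNorm_coeffs _ _ _) (expNorm_coeffs _ _ _)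
        _ = 4 ^ q := by rw [← mul_pow]; norm_num
        _ ≤ 8 ^ q := Nat.pow_le_pow_left (by norm_num) _
    rw [pow_succ 8 q, ← mul_assoc]
    omega

theorem near_S_zpow_T_zpow {N : ℕ} {j k : ℤ} (hj : j.natAbs ≤ N) (hk : k.natAbs ≤ N) :
    Near baumslagRels (N * N) (S ^ j * T ^ k) (T ^ k * S ^ j) := by
  refine (near_S_T.zpow_commute_zpow j k).mono ?_
  rw [mul_one]
  exact Nat.mul_le_mul hj hk

/-- `t ^ n * s ^ n`, by which words of length at most `n` are conjugated in order to avoid negative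
exponents. -/
def shiftElt (n : ℕ) : FreeGroup Gen := T ^ n * S ^ n

/-- A generous bound for the cost of absorbing one letter into the normal form of a word of length
at most `n`. -/
def stepCost (n : ℕ) : ℕ := 2 ^ (30 * n + 10)

/-- Absorbing the letter `a` into `t ^ j * s ^ k`: conjugation by `t ^ (n - j) * s ^ (n - k)`, which
has nonnegative exponents, turns it into a normal form. -/
theorem near_absorb_A {n : ℕ} {j k : ℤ} (hj : j.natAbs ≤ n) (hk : k.natAbs ≤ n) :
    ∃ e : ℕ → ℤ, expNorm e (4 * n + 1) ≤ 4 ^ n ∧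
      Near baumslagRels (8 * n * n + 8 ^ (4 * n) * 8 ^ (2 * n))
        (T ^ j * S ^ k * ((shiftElt n)⁻¹ * A * shiftElt n))
        (powProd aConj e (4 * n + 1) * (T ^ j * S ^ k)) := by
  obtain ⟨p, hp⟩ := Int.eq_ofNat_of_zero_le (show 0 ≤ (n : ℤ) - j by omega)
  obtain ⟨q, hq⟩ := Int.eq_ofNat_of_zero_le (show 0 ≤ (n : ℤ) - k by omega)
  refine ⟨coeffs p q, (expNorm_coeffs _ _ _).trans ?_, ?_⟩
  · calc 2 ^ q ≤ 2 ^ (2 * n) := Nat.pow_le_pow_right (by norm_num) (by omega)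
      _ = 4 ^ n := by rw [pow_mul]; norm_num
  have hV : Near baumslagRels (2 * n * (2 * n))
      (shiftElt n * (T ^ j * S ^ k)⁻¹) (T ^ p * S ^ q) := by
    have h := (near_S_zpow_T_zpow (N := 2 * n) (j := q) (k := -j) (by omega) (by omega)).mul_left
      (T ^ n)
    have e1 : shiftElt n * (T ^ j * S ^ k)⁻¹ = T ^ n * (S ^ (q : ℤ) * T ^ (-j)) := by
      rw [← hq, shiftElt, ← zpow_natCast S, zpow_sub]
      group
    have e2 : T ^ p * S ^ q = T ^ n * (T ^ (-j) * S ^ (q : ℤ)) := by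
      rw [← zpow_natCast T p, ← hp, sub_eq_add_neg, zpow_add, zpow_natCast, zpow_natCast, mul_assoc]
    rwa [e1, e2]
  have h1 := (hV.inv.mul_right A).mul hV
  have h2 := near_conj_S_pow (m := 4 * n) q p (by omega)
  have e3 : (T ^ p * S ^ q)⁻¹ * A * (T ^ p * S ^ q) = (S ^ q)⁻¹ * aConj p * S ^ q := by
    rw [aConj]; group
  rw [e3] at h1
  have h3 := (h1.trans h2).mul_right (T ^ j * S ^ k)
  have e4 : T ^ j * S ^ k * ((shiftElt n)⁻¹ * A * shiftElt n) = (shiftElt n * (T ^ j * S ^ k)⁻¹)⁻¹ *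
      A * (shiftElt n * (T ^ j * S ^ k)⁻¹) * (T ^ j * S ^ k) := by group
  rw [e4]
  refine h3.mono ?_
  have : 8 ^ q ≤ 8 ^ (2 * n) := Nat.pow_le_pow_right (by norm_num) (by omega)
  have := Nat.mul_le_mul_left (8 ^ (4 * n)) this
  nlinarith

theorem near_absorb_T {n : ℕ} {j k ε : ℤ} (hk : k.natAbs ≤ n) (hε : ε.natAbs = 1) :
    Near baumslagRels (2 * n) (T ^ j * S ^ k * ((shiftElt n)⁻¹ * T ^ ε * shiftElt n))
      (T ^ (j + ε) * S ^ k) := by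
  have h1 : Near baumslagRels n (T ^ ε * S ^ n) (S ^ n * T ^ ε) := by
    have := near_S_T.zpow_commute_zpow n ε
    rw [hε, zpow_natCast] at this
    simpa using this.symm
  have h2 : Near baumslagRels n (S ^ k * T ^ ε) (T ^ ε * S ^ k) := by
    have := near_S_T.zpow_commute_zpow k ε
    rw [hε] at this
    exact this.mono (by omega)
  have e1 : T ^ j * S ^ k * ((shiftElt n)⁻¹ * T ^ ε * shiftElt n)
      = T ^ j * S ^ k * (S ^ n)⁻¹ * (T ^ ε * S ^ n) := by
    rw [shiftElt]; group
  have h3 := (h1.mul_left (T ^ j * S ^ k * (S ^ n)⁻¹))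
  have h4 := h2.mul_left (T ^ j)
  have e2 : T ^ j * S ^ k * (S ^ n)⁻¹ * (S ^ n * T ^ ε) = T ^ j * (S ^ k * T ^ ε) := by group
  rw [e2] at h3
  have e3 : T ^ (j + ε) * S ^ k = T ^ j * (T ^ ε * S ^ k) := by rw [zpow_add, mul_assoc]
  rw [e1, e3]
  exact (h3.trans h4).mono (by omega)

theorem near_absorb_S {n : ℕ} {j k ε : ℤ} (hε : ε.natAbs = 1) :
    Near baumslagRels n (T ^ j * S ^ k * ((shiftElt n)⁻¹ * S ^ ε * shiftElt n))
      (T ^ j * S ^ (k + ε)) := by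
  have h1 : Near baumslagRels n (S ^ ε * T ^ n) (T ^ n * S ^ ε) := by
    have := near_S_T.zpow_commute_zpow ε n
    rw [hε, zpow_natCast] at this
    simpa using this
  have h2 := (h1.mul_left (T ^ j * S ^ k * (shiftElt n)⁻¹)).mul_right (S ^ n)
  have e1 : T ^ j * S ^ k * ((shiftElt n)⁻¹ * S ^ ε * shiftElt n)
      = T ^ j * S ^ k * (shiftElt n)⁻¹ * (S ^ ε * T ^ n) * S ^ n := by
    rw [shiftElt]; group
  have e2 : T ^ j * S ^ (k + ε) = T ^ j * S ^ k * (shiftElt n)⁻¹ * (T ^ n * S ^ ε) * S ^ n := by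
    rw [shiftElt, zpow_add]; group
  rw [e1, e2]
  exact h2

theorem stepCost_bound (n : ℕ) : (8 * n * n + 8 ^ (4 * n) * 8 ^ (2 * n)) +
    8 ^ (4 * n) * 4 ^ n * 4 ^ n + 8 ^ (4 * n) * (n * 4 ^ n) * 4 ^ n ≤ stepCost n := by
  have e : stepCost n = 1024 * 2 ^ (30 * n) := by rw [stepCost, pow_add]; ring
  have h8 : ∀ k, 8 ^ k = 2 ^ (3 * k) := fun k => by rw [pow_mul]; rfl
  have h4 : 4 ^ n = 2 ^ (2 * n) := by rw [pow_mul]; norm_num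
  have hn : n ≤ 2 ^ n := Nat.lt_pow_self (by norm_num) |>.le
  have mono : ∀ {k}, k ≤ 30 * n → 2 ^ k ≤ 2 ^ (30 * n) := fun h =>
    Nat.pow_le_pow_right (by norm_num) h
  have h1 : 8 * n * n ≤ 8 * 2 ^ (30 * n) := by
    calc 8 * n * n = 8 * (n * n) := by ring
      _ ≤ 8 * (2 ^ n * 2 ^ n) := by gcongr
      _ = 8 * 2 ^ (n + n) := by rw [pow_add]
      _ ≤ _ := Nat.mul_le_mul_left _ (mono (by omega))
  have h2 : 8 ^ (4 * n) * 8 ^ (2 * n) ≤ 2 ^ (30 * n) := by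
    rw [h8, h8, ← pow_add]
    exact mono (by omega)
  have h3 : 8 ^ (4 * n) * 4 ^ n * 4 ^ n ≤ 2 ^ (30 * n) := by
    rw [h8, h4, ← pow_add, ← pow_add]
    exact mono (by omega)
  have h5 : 8 ^ (4 * n) * (n * 4 ^ n) * 4 ^ n ≤ 2 ^ (30 * n) := by
    calc _ ≤ 8 ^ (4 * n) * (2 ^ n * 4 ^ n) * 4 ^ n := by gcongr
      _ ≤ _ := by
        rw [h8, h4, ← pow_add, ← pow_add, ← pow_add]
        exact mono (by omega)
  omega

/-- Every word of length `l ≤ n`, conjugated by `t ^ n * s ^ n`, is brought to the form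
`∏ a_i ^ e_i * t ^ j * s ^ k`, letter by letter. -/
theorem near_normalForm {n : ℕ} (w : List (Gen × Bool)) (hw : w.length ≤ n) :
    ∃ (e : ℕ → ℤ) (j k : ℤ), j.natAbs ≤ w.length ∧ k.natAbs ≤ w.length ∧
      expNorm e (4 * n + 1) ≤ w.length * 4 ^ n ∧
      Near baumslagRels (w.length * stepCost n) ((shiftElt n)⁻¹ * FreeGroup.mk w * shiftElt n)
        (powProd aConj e (4 * n + 1) * (T ^ j * S ^ k)) := by
  induction w using List.reverseRecOn with
  | nil =>
    refine ⟨0, 0, 0, by simp, by simp, by simp [expNorm], Near.of_eq ?_⟩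
    rw [powProd_zero _ (fun i _ => Pi.zero_apply i), ← FreeGroup.one_eq_mk]
    simp
  | append_singleton w x ih =>
    rw [List.length_append, List.length_singleton] at hw
    obtain ⟨e, j, k, hj, hk, he, h⟩ := ih (by omega)
    clear ih
    have hlen : (w ++ [x]).length = w.length + 1 := by simp
    set m := 4 * n + 1 with hm
    have hcost := stepCost_bound n
    have split : (shiftElt n)⁻¹ * FreeGroup.mk (w ++ [x]) * shiftElt n =
        (shiftElt n)⁻¹ * FreeGroup.mk w * shiftElt n *
          ((shiftElt n)⁻¹ * FreeGroup.mk [x] * shiftElt n) := by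
      rw [← FreeGroup.mul_mk]; group
    have h1 := h.mul_right ((shiftElt n)⁻¹ * FreeGroup.mk [x] * shiftElt n)
    rw [← split, mul_assoc (powProd aConj e m)] at h1
    rw [hlen, Nat.succ_mul, Nat.succ_mul]
    have finish : ∀ {N : ℕ} {e' : ℕ → ℤ} {j' k' : ℤ}, N ≤ stepCost n →
        Near baumslagRels N (powProd aConj e m * (T ^ j * S ^ k *
          ((shiftElt n)⁻¹ * FreeGroup.mk [x] * shiftElt n)))
          (powProd aConj e' m * (T ^ j' * S ^ k')) →
        Near baumslagRels (w.length * stepCost n + stepCost n)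
          ((shiftElt n)⁻¹ * FreeGroup.mk (w ++ [x]) * shiftElt n)
          (powProd aConj e' m * (T ^ j' * S ^ k')) :=
      fun hN h' => (h1.trans h').mono (by omega)
    obtain ⟨ε, hε, hx⟩ : ∃ ε : ℤ, ε.natAbs = 1 ∧ FreeGroup.mk [x] = FreeGroup.of x.1 ^ ε := by
      obtain ⟨x, _ | _⟩ := x
      · exact ⟨-1, rfl, by rw [zpow_neg_one]; rfl⟩
      · exact ⟨1, rfl, by rw [zpow_one]; rfl⟩
    obtain ⟨x, b⟩ := x
    simp only at hx
    rw [hx] at finish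
    cases x with
    | t =>
      refine ⟨e, j + ε, k, by omega, by omega, he.trans (Nat.le_add_right _ _), finish ?_
        ((near_absorb_T (n := n) (by omega) hε).mul_left _)⟩
      have : 2 * n ≤ 8 * n * n := by nlinarith
      omega
    | s =>
      refine ⟨e, j, k + ε, by omega, by omega, he.trans (Nat.le_add_right _ _), finish ?_
        ((near_absorb_S (n := n) hε).mul_left _)⟩
      have : n ≤ 8 * n * n := by nlinarith
      omega
    | a =>
      have hcomm : ∀ i < m, ∀ j < m, Near baumslagRels (8 ^ (4 * n)) (aConj i * aConj j)
          (aConj j * aConj i) := fun i hi j hj => near_aConj_comm (by omega) (by omega)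
      obtain ⟨f, hf, h2⟩ : ∃ f : ℕ → ℤ, expNorm f m ≤ 4 ^ n ∧
          Near baumslagRels ((8 * n * n + 8 ^ (4 * n) * 8 ^ (2 * n)) + 8 ^ (4 * n) * 4 ^ n * 4 ^ n)
            (T ^ j * S ^ k * ((shiftElt n)⁻¹ * A ^ ε * shiftElt n))
            (powProd aConj f m * (T ^ j * S ^ k)) := by
        obtain ⟨f, hf, h2⟩ := near_absorb_A (n := n) (j := j) (k := k) (by omega) (by omega)
        rcases Int.natAbs_eq_iff.1 hε with rfl | rfl
        · exact ⟨f, hf, by simpa using h2.mono (Nat.le_add_right _ _)⟩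
        · refine ⟨-f, by rwa [expNorm_neg], ?_⟩
          have h3 := (h2.mul_right (T ^ j * S ^ k)⁻¹).inv.mul_right (T ^ j * S ^ k)
          rw [mul_inv_cancel_right] at h3
          have h4 := (h3.trans ((Near.powProd_neg f hcomm).mul_right (T ^ j * S ^ k)))
          have e1 : (T ^ j * S ^ k * ((shiftElt n)⁻¹ * A * shiftElt n) * (T ^ j * S ^ k)⁻¹)⁻¹ *
              (T ^ j * S ^ k)
              = T ^ j * S ^ k * ((shiftElt n)⁻¹ * A ^ (-((1 : ℕ) : ℤ)) * shiftElt n) := by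
            simp only [Nat.cast_one, zpow_neg_one]
            group
          rw [e1] at h4
          refine h4.mono ?_
          gcongr
      have h3 := h2.mul_left (powProd aConj e m)
      have h4 := (Near.powProd_mul e f hcomm).mul_right (T ^ j * S ^ k)
      rw [mul_assoc (powProd aConj e m)] at h4
      have hlin : w.length * 4 ^ n ≤ n * 4 ^ n := Nat.mul_le_mul_right _ (by omega)
      refine ⟨e + f, j, k, by omega, by omega, (expNorm_add e f m).trans (by omega),
        finish ?_ (h3.trans h4)⟩
      have : 8 ^ (4 * n) * expNorm e m * expNorm f m ≤ 8 ^ (4 * n) * (n * 4 ^ n) * 4 ^ n := by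
        gcongr
        omega
      omega

/-! ### Uniqueness of the normal form -/

theorem mk_eq_one_of_lift {G : Type*} [Group G] {f : Gen → G}
    (h : ∀ r ∈ baumslagRels, FreeGroup.lift f r = 1) {g : FreeGroup Gen}
    (hg : PresentedGroup.mk baumslagRels g = 1) : FreeGroup.lift f g = 1 := by
  have : PresentedGroup.toGroup h (PresentedGroup.mk baumslagRels g) = FreeGroup.lift f g := rfl
  rw [← this, hg, map_one]

/-- The exponent sums in `t` and `s`. -/
def expSum : Gen → Multiplicative (ℤ × ℤ)
  | .a => 1
  | .t => .ofAdd (1, 0)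
  | .s => .ofAdd (0, 1)

theorem lift_expSum_rels : ∀ r ∈ baumslagRels, FreeGroup.lift expSum r = 1 := by
  rintro r (rfl | rfl | rfl) <;> simp [comm, conjBy, expSum]

/-- The action of the generators by affine maps of a field: `a` is `z ↦ z + 1`, and conjugation by
`t` and by `s` multiplies translations by `x` and by `1 + x`. -/
noncomputable def affineAction (F : Type*) [Field F] (x y : F) (hx : x ≠ 0) (hy : y ≠ 0) :
    Gen → Equiv.Perm F
  | .a => Equiv.addRight 1
  | .t => (Equiv.mulRight₀ x hx).symm
  | .s => (Equiv.mulRight₀ y hy).symm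

section Affine

variable {F : Type*} [Field F] {x y : F} {hx : x ≠ 0} {hy : y ≠ 0}

theorem lift_affineAction_rels (hxy : y = 1 + x) :
    ∀ r ∈ baumslagRels, FreeGroup.lift (affineAction F x y hx hy) r = 1 := by
  rintro r (rfl | rfl | rfl) <;> ext z <;>
    simp [comm, conjBy, affineAction, Equiv.Perm.inv_def]
  all_goals first | (field_simp; done) | (field_simp; subst hxy; ring)

theorem lift_affineAction_aConj (i : ℕ) (z : F) :
    FreeGroup.lift (affineAction F x y hx hy) (aConj i) z = z + x ^ i := by
  induction i generalizing z with
  | zero => simp [aConj, affineAction]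
  | succ i ih =>
    rw [add_comm i 1, aConj_add]
    simp [ih, affineAction, Equiv.Perm.inv_def]
    field_simp
    rw [add_comm 1 i, pow_succ']

theorem lift_affineAction_powProd (e : ℕ → ℤ) (m : ℕ) (z : F) :
    FreeGroup.lift (affineAction F x y hx hy) (powProd aConj e m) z
      = z + ∑ i ∈ Finset.range m, (e i : F) * x ^ i := by
  have hpow : ∀ i, FreeGroup.lift (affineAction F x y hx hy) (aConj i) = Equiv.addRight (x ^ i) :=
    fun i => Equiv.ext fun z => lift_affineAction_aConj i z
  induction m generalizing z with
  | zero => simp [powProd]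
  | succ m ih =>
    rw [powProd, map_mul, map_zpow, hpow, Equiv.zsmul_addRight, Equiv.Perm.mul_apply, ih,
      Finset.sum_range_succ]
    simp
    ring

end Affine

/-- With `x` transcendental, the affine action separates the normal forms. -/
theorem exponents_eq_zero {e : ℕ → ℤ} {m : ℕ}
    (h : PresentedGroup.mk baumslagRels (powProd aConj e m) = 1) : ∀ i < m, e i = 0 := by
  obtain ⟨x, htr⟩ : ∃ x : ℝ, Transcendental ℤ x := ⟨_, transcendental_liouvilleNumber le_rfl⟩
  have hx : x ≠ 0 := fun h0 => htr (h0 ▸ isAlgebraic_zero)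
  have hy : 1 + x ≠ 0 := fun h0 => htr (by
    rw [eq_neg_of_add_eq_zero_right h0]
    exact isAlgebraic_one.neg)
  have h1 := mk_eq_one_of_lift (lift_affineAction_rels (hx := hx) (hy := hy) rfl) h
  have h2 := lift_affineAction_powProd (hx := hx) (hy := hy) e m 0
  rw [h1, Equiv.Perm.one_apply, zero_add] at h2
  have h3 : Polynomial.aeval x (∑ i ∈ Finset.range m, Polynomial.monomial i (e i)) = 0 := by
    rw [map_sum, h2]
    simp [Polynomial.aeval_monomial]
  have h4 := (transcendental_iff.1 htr) _ h3
  intro i hi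
  have h5 := congrArg (fun p => Polynomial.coeff p i) h4
  simpa [Polynomial.finsetSum_coeff, Polynomial.coeff_monomial, hi] using h5

theorem areaLE_of_representsOne {n : ℕ} {w : List (Gen × Bool)} (hw : w.length ≤ n)
    (h : RepresentsOne baumslagRels w) :
    AreaLE baumslagRels (n * stepCost n) (FreeGroup.mk w) := by
  obtain ⟨e, j, k, -, -, -, hN⟩ := near_normalForm w hw
  have hmk : PresentedGroup.mk baumslagRels
      (powProd aConj e (4 * n + 1) * (T ^ j * S ^ k)) = 1 := by
    rw [← hN.mk_eq, map_mul, map_mul,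
      show PresentedGroup.mk baumslagRels (FreeGroup.mk w) = 1 from h]
    simp
  have hsum := mk_eq_one_of_lift lift_expSum_rels hmk
  have ha : ∀ i, FreeGroup.lift expSum (aConj i) = 1 := by simp [aConj, expSum]
  rw [map_mul, map_powProd] at hsum
  have hp : powProd (fun i => FreeGroup.lift expSum (aConj i)) e (4 * n + 1) = 1 := by
    simp only [ha]
    generalize 4 * n + 1 = m
    induction m with
    | zero => rfl
    | succ m ih => simp [powProd, ih]
  rw [hp, one_mul, map_mul, map_zpow, map_zpow, FreeGroup.lift_apply_of, FreeGroup.lift_apply_of,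
    expSum, expSum, ← ofAdd_zsmul, ← ofAdd_zsmul, ← ofAdd_add, ofAdd_eq_one] at hsum
  simp only [Prod.ext_iff, Prod.fst_add, Prod.snd_add, Prod.smul_fst, Prod.smul_snd] at hsum
  obtain rfl : j = 0 := by simpa using hsum.1
  obtain rfl : k = 0 := by simpa using hsum.2
  rw [zpow_zero, zpow_zero, one_mul, mul_one] at hmk hN
  rw [powProd_zero _ (exponents_eq_zero hmk)] at hN
  have h1 : AreaLE baumslagRels (w.length * stepCost n)
      ((shiftElt n)⁻¹ * FreeGroup.mk w * shiftElt n) := by simpa [Near] using hN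
  have h2 := h1.conj (shiftElt n)⁻¹
  refine AreaLE.mono ?_ (Nat.mul_le_mul_right _ hw)
  convert h2 using 1
  group

theorem dehnFunction_asympLE_two_pow :
    AsympLE (dehnFunction baumslagRels) (fun n => 2 ^ n) := by
  refine ⟨31, by norm_num, fun n => ?_⟩
  have h : dehnFunction baumslagRels n ≤ n * stepCost n :=
    dehnFunction_le fun w hw h1 => areaLE_of_representsOne hw h1
  have hn : n ≤ 2 ^ n := (Nat.lt_pow_self (by norm_num)).le
  calc dehnFunction baumslagRels n ≤ 2 ^ n * stepCost n := h.trans (Nat.mul_le_mul_right _ hn)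
    _ = 2 ^ (31 * n + 10) := by rw [stepCost, ← pow_add]; congr 1; ring
    _ ≤ 2 ^ (31 * n + 31) := Nat.pow_le_pow_right (by norm_num) (by omega)
    _ ≤ _ := by dsimp only; omega

end Upper

/-! ### The exponential lower bound -/

section Lower

open Real
open scoped goldenRatio

/-- The translation of the plane by `c` in the first coordinate. -/
def translation (c : ℝ) : Equiv.Perm (ℝ × ℝ) := Equiv.addRight (c, 0)

@[simp] theorem translation_apply (c : ℝ) (z : ℝ × ℝ) : translation c z = (z.1 + c, z.2) := by
  simp [translation, Prod.ext_iff]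

theorem translation_add (c d : ℝ) : translation (c + d) = translation c * translation d := by
  ext z <;> simp [add_assoc, add_comm d c]

theorem translation_injective : Function.Injective translation := by
  intro c d h
  simpa using congrArg (fun f : Equiv.Perm (ℝ × ℝ) => (f 0).1) h

/-- The action of the generators on the plane that detects area: `a` is an element of the Heisenberg
group of upper unitriangular matrices of size three, acting on the affine plane, and `t`, `s` are
diagonal. Conjugation by `t` multiplies the two entries above the diagonal by `φ` and `ψ`, and
conjugation by `s` by `1 + φ` and `1 + ψ`; hence they multiply the central entry by
`φ * ψ = -1` and by `(1 + φ) * (1 + ψ) = 1`. -/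
noncomputable def heisenbergAction : Gen → Equiv.Perm (ℝ × ℝ)
  | .a =>
    { toFun := fun z => (z.1 + z.2, z.2 + 1)
      invFun := fun z => (z.1 - (z.2 - 1), z.2 - 1)
      left_inv := fun z => by simp
      right_inv := fun z => by simp }
  | .t =>
    { toFun := fun z => (-z.1, -φ * z.2)
      invFun := fun z => (-z.1, ψ * z.2)
      left_inv := fun z => by
        ext
        · simp
        · linear_combination (-z.2) * goldenRatio_mul_goldenConj
      right_inv := fun z => by
        ext
        · simp
        · linear_combination (-z.2) * goldenRatio_mul_goldenConj }
  | .s =>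
    { toFun := fun z => (z.1, φ ^ 2 * z.2)
      invFun := fun z => (z.1, ψ ^ 2 * z.2)
      left_inv := fun z => by
        ext
        · simp
        · linear_combination z.2 * (φ * ψ - 1) * goldenRatio_mul_goldenConj
      right_inv := fun z => by
        ext
        · simp
        · linear_combination z.2 * (φ * ψ - 1) * goldenRatio_mul_goldenConj }

/-- The elements of the free group act by affine maps that normalise the translations. -/
theorem conj_translation (g : FreeGroup Gen) :
    ∃ ε : ℝ, |ε| = 1 ∧ ∀ c, (FreeGroup.lift heisenbergAction g)⁻¹ * translation c *
      FreeGroup.lift heisenbergAction g = translation (ε * c) := by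
  induction g using FreeGroup.induction_on with
  | C1 => exact ⟨1, by simp, by simp⟩
  | of x =>
    cases x
    · refine ⟨1, by simp, fun c => ?_⟩
      ext z <;> simp [heisenbergAction, Equiv.Perm.inv_def]
      ring
    · refine ⟨1, by simp, fun c => ?_⟩
      ext z <;> simp [heisenbergAction, Equiv.Perm.inv_def]
      linear_combination z.2 * (goldenRatio_mul_goldenConj + goldenRatio_add_goldenConj)
    · refine ⟨-1, by simp, fun c => ?_⟩
      ext z <;> simp [heisenbergAction, Equiv.Perm.inv_def]
      · ring
      · linear_combination (-z.2) * goldenRatio_mul_goldenConj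
  | inv_of x ih =>
    obtain ⟨ε, hε, h⟩ := ih
    have h2 : ε * ε = 1 := by rw [← abs_mul_abs_self, hε, one_mul]
    refine ⟨ε, hε, fun c => ?_⟩
    have h1 := h (ε * c)
    rw [← mul_assoc, h2, one_mul] at h1
    rw [map_inv, ← h1]
    group
  | mul x y hx hy =>
    obtain ⟨ε, hε, hx⟩ := hx
    obtain ⟨δ, hδ, hy⟩ := hy
    refine ⟨δ * ε, by rw [abs_mul, hε, hδ, one_mul], fun c => ?_⟩
    rw [mul_assoc δ, ← hy, ← hx, map_mul]
    group

theorem lift_aConj_apply (i : ℕ) (z : ℝ × ℝ) :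
    FreeGroup.lift heisenbergAction (aConj i) z = (z.1 + φ ^ i * z.2, z.2 + ψ ^ i) := by
  induction i generalizing z with
  | zero => simp [aConj, heisenbergAction]
  | succ i ih =>
    rw [add_comm i 1, aConj_add]
    have h := goldenRatio_mul_goldenConj
    simp only [pow_one, map_mul, map_inv, FreeGroup.lift_apply_of, Equiv.Perm.mul_apply, ih,
      Equiv.Perm.inv_def]
    ext
    · simp [heisenbergAction]
      ring
    · simp [heisenbergAction]
      linear_combination (-z.2) * h

theorem lift_aConj_comm (i : ℕ) :
    FreeGroup.lift heisenbergAction (comm (aConj 0) (aConj i)) = translation (ψ ^ i - φ ^ i) := by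
  have h : FreeGroup.lift heisenbergAction (aConj 0 * aConj i) =
      FreeGroup.lift heisenbergAction (aConj i * aConj 0) * translation (ψ ^ i - φ ^ i) := by
    ext z <;> simp [lift_aConj_apply] <;> ring
  have h1 : comm (aConj 0) (aConj i) = (aConj i * aConj 0)⁻¹ * (aConj 0 * aConj i) := by
    simp only [comm]; group
  rw [h1, map_mul, h, map_inv, inv_mul_cancel_left]

theorem lift_rel_eq_translation {r : FreeGroup Gen} (hr : r ∈ baumslagRels) :
    ∃ c : ℝ, |c| ≤ 3 ∧ FreeGroup.lift heisenbergAction r = translation c := by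
  have h1 := goldenRatio_lt_two
  have h2 := goldenRatio_pos
  have h3 := neg_one_lt_goldenConj
  have h4 := goldenConj_neg
  rcases hr with rfl | rfl | rfl
  · refine ⟨ψ ^ 1 - φ ^ 1, ?_, ?_⟩
    · rw [pow_one, pow_one, abs_le]
      constructor <;> linarith
    · rw [← lift_aConj_comm]
      simp [aConj, conjBy]
  · refine ⟨0, by simp, ?_⟩
    simp only [comm, map_mul, map_inv, FreeGroup.lift_apply_of]
    have : heisenbergAction .s * heisenbergAction .t
        = heisenbergAction .t * heisenbergAction .s := by
      ext z <;> simp [heisenbergAction]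
      ring
    rw [mul_assoc, this]
    ext z <;> simp
  · refine ⟨-ψ, ?_, ?_⟩
    · rw [abs_le]
      constructor <;> linarith
    · have e : FreeGroup.of Gen.a * conjBy (FreeGroup.of Gen.a) (FreeGroup.of Gen.t)
          = aConj 0 * aConj 1 := by simp [aConj, conjBy]
      rw [e, map_mul, map_inv, mul_inv_eq_iff_eq_mul]
      ext z
      · simp [lift_aConj_apply, conjBy, heisenbergAction, Equiv.Perm.inv_def, goldenRatio_sq]
        ring
      · simp [lift_aConj_apply, conjBy, heisenbergAction, Equiv.Perm.inv_def]
        linear_combination z.2 * (goldenRatio_mul_goldenConj + goldenRatio_add_goldenConj)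

/-- An element of area at most `N` acts by a translation of length at most `3 * N`. -/
theorem AreaLE.lift_eq_translation {N : ℕ} {g : FreeGroup Gen} (hg : AreaLE baumslagRels N g) :
    ∃ c : ℝ, |c| ≤ 3 * N ∧ FreeGroup.lift heisenbergAction g = translation c := by
  obtain ⟨l, hl, h1, rfl⟩ := hg
  suffices h : ∃ c : ℝ, |c| ≤ 3 * l.length ∧ FreeGroup.lift heisenbergAction
      (l.map fun p => p.1⁻¹ * p.2 * p.1).prod = translation c by
    obtain ⟨c, hc, h⟩ := h
    exact ⟨c, hc.trans (by gcongr), h⟩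
  clear hl
  induction l with
  | nil => exact ⟨0, by simp, by ext z <;> simp⟩
  | cons p l ih =>
    obtain ⟨c, hc, ih⟩ := ih fun q hq => h1 q (by simp [hq])
    obtain ⟨d, hd, h⟩ : ∃ d : ℝ, |d| ≤ 3 ∧ FreeGroup.lift heisenbergAction p.2 = translation d := by
      rcases h1 p (by simp) with h | h
      · exact lift_rel_eq_translation h
      · obtain ⟨d, hd, h⟩ := lift_rel_eq_translation h
        refine ⟨-d, by rwa [abs_neg], ?_⟩
        rw [map_inv, inv_eq_iff_eq_inv] at h
        rw [h, inv_eq_iff_mul_eq_one, ← translation_add]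
        ext z <;> simp
    obtain ⟨ε, hε, hconj⟩ := conj_translation p.1
    refine ⟨ε * d + c, ?_, ?_⟩
    · refine (abs_add_le _ _).trans ?_
      rw [abs_mul, hε, List.length_cons]
      push_cast
      linarith
    · rw [List.map_cons, List.prod_cons, map_mul, ih, map_mul, map_mul, map_inv, h, hconj,
        translation_add]

theorem exists_word_aConj_comm (i : ℕ) : ∃ w : List (Gen × Bool), w.length ≤ 4 * i + 4 ∧
    FreeGroup.mk w = comm (aConj 0) (aConj i) := by
  classical
  refine ⟨(comm (aConj 0) (aConj i)).toWord, ?_, FreeGroup.mk_toWord⟩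
  change (comm (aConj 0) (aConj i)).norm ≤ _
  have h0 : (aConj 0).norm = 1 := by simp [aConj]
  have hi : (aConj i).norm ≤ 2 * i + 1 := by
    refine (FreeGroup.norm_mul_le _ _).trans ?_
    have h := FreeGroup.norm_mul_le (FreeGroup.of Gen.t ^ i)⁻¹ (FreeGroup.of Gen.a)
    rw [FreeGroup.norm_of, FreeGroup.norm_inv_eq, FreeGroup.norm_of_pow] at h
    rw [FreeGroup.norm_of_pow]
    omega
  have h1 := FreeGroup.norm_mul_le ((aConj 0)⁻¹ * (aConj i)⁻¹ * aConj 0) (aConj i)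
  have h2 := FreeGroup.norm_mul_le ((aConj 0)⁻¹ * (aConj i)⁻¹) (aConj 0)
  have h3 := FreeGroup.norm_mul_le (aConj 0)⁻¹ (aConj i)⁻¹
  rw [FreeGroup.norm_inv_eq, FreeGroup.norm_inv_eq] at h3
  rw [comm]
  omega

theorem two_pow_asympLE_dehnFunction :
    AsympLE (fun n => 2 ^ n) (dehnFunction baumslagRels) := by
  refine ⟨8, by norm_num, fun n => ?_⟩
  obtain ⟨w, hw, hwc⟩ := exists_word_aConj_comm (2 * n)
  have hone : RepresentsOne baumslagRels w := by
    have h := (near_aConj_zero_comm (2 * n)).mk_eq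
    rw [map_mul, map_mul] at h
    rw [RepresentsOne, hwc, comm, map_mul, map_mul, map_mul, map_inv, map_inv, mul_assoc, h]
    group
  have hle : area baumslagRels w ≤ dehnFunction baumslagRels (8 * n + 8) :=
    area_le_dehnFunction (by omega) hone
  obtain ⟨c, hc, h⟩ := (areaLE_area hone).lift_eq_translation
  rw [hwc, lift_aConj_comm] at h
  obtain rfl := translation_injective h
  -- `φ ^ (2 * n) ≥ 2 ^ n` because `φ ^ 2 = φ + 1 ≥ 2`.
  have hφ : (2 : ℝ) ^ n ≤ φ ^ (2 * n) := by
    rw [pow_mul, goldenRatio_sq]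
    exact pow_le_pow_left₀ (by norm_num) (by linarith [one_lt_goldenRatio]) n
  have hψ : ψ ^ (2 * n) ≤ 1 := by
    rw [pow_mul]
    exact pow_le_one₀ (sq_nonneg _) (by nlinarith [neg_one_lt_goldenConj, goldenConj_neg])
  have h1 : (2 : ℝ) ^ n ≤ 3 * area baumslagRels w + 1 := by
    linarith [neg_abs_le (ψ ^ (2 * n) - φ ^ (2 * n))]
  have h2 : 2 ^ n ≤ 3 * area baumslagRels w + 1 := by exact_mod_cast h1
  dsimp only
  omega

end Lower

theorem dehnFunction_baumslagRels :
    AsympEquiv (dehnFunction baumslagRels) (fun n => 2 ^ n) :=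
  ⟨dehnFunction_asympLE_two_pow, two_pow_asympLE_dehnFunction⟩

end BaumslagDehn

/-- The Dehn function of Baumslag's group is equivalent to `2 ^ n`: for its defining presentation,
and for every finite presentation of the group. -/
theorem theorem1 :
    BaumslagDehn.AsympEquiv (BaumslagDehn.dehnFunction BaumslagDehn.baumslagRels)
      (fun n => 2 ^ n) ∧
    ∀ (α : Type*) [Finite α] (R : Set (FreeGroup α)), R.Finite →
      Nonempty (PresentedGroup R ≃* BaumslagDehn.BaumslagGroup) →
      BaumslagDehn.AsympEquiv (BaumslagDehn.dehnFunction R) (fun n => 2 ^ n) := by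
  refine ⟨BaumslagDehn.dehnFunction_baumslagRels, ?_⟩
  rintro α _ R hR ⟨e⟩
  have hB : BaumslagDehn.baumslagRels.Finite := by
    rw [BaumslagDehn.baumslagRels]
    exact Set.toFinite _
  exact ⟨(BaumslagDehn.dehnFunction_asympLE_of_mulEquiv hB e).trans
      (fun m n h => Nat.pow_le_pow_right (by norm_num) h)
      BaumslagDehn.dehnFunction_asympLE_two_pow,
    BaumslagDehn.two_pow_asympLE_dehnFunction.trans BaumslagDehn.dehnFunction_mono
      (BaumslagDehn.dehnFunction_asympLE_of_mulEquiv hR e.symm)⟩
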